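/- For $M>1$ and $\alpha\in\mathbb R$ let $$K_{\exp}(\alpha)=\{x\in[1/M,M]^2\times\mathbb R:\ \log(x_1/x_2)\ge x_3/x_2-\alpha\},$$ and let $\mathcal L_3=\{y\in\mathbb R^3: y_3\ge\sqrt{y_1^2+y_2^2}\}$. Let $\epsilon\in(0,1]$ and let $C_q\subseteq\mathbb R^3$ be an SOC approximation of the exponential cone with $p$ additional variables and $m$ SOC constraints, $q=p+m$; that is, there are $A_1,A_2,A_3\in\mathbb R^{m\times(3+p)}$ and $b_1,b_2,b_3\in\mathbb R^m$ such that $$C_q=\{x\in\mathbb R^3:\ \exists y\in\mathbb R^p,\ \big((A_1z+b_1)_i,(A_2z+b_2)_i,(A_3z+b_3)_i\big)\in\mathcal L_3\ \text{ for } i=1,\dots,m,\ \text{ where } z=(x,y)\},$$ and $K_{\exp}(-\epsilon)\subseteq C_q\subseteq K_{\exp}(\epsilon)$. Then $q=\Omega\big(1+\log\log M/\log(1/\epsilon)\big)$, in the following precise sense. (i) There is an absolute constant $c>0$ such that for all $M>1$, all $\epsilon\in(0,1]$ and all such $C_q$, $$q\ \ge\ c\left(1+\frac{\log\log M}{1+\log(1/\epsilon)}\right).$$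 (ii) For every $\epsilon_0\in(0,1)$ there is a constant $c>0$ depending only on $\epsilon_0$ such that for all $M>1$, all $\epsilon\in(0,\epsilon_0]$ and all such $C_q$, $$q\ \ge\ c\left(1+\frac{\log\log M}{\log(1/\epsilon)}\right).$$ -/

import Mathlib

namespace ExpCone

/-- The hypograph of the natural logarithm shifted by `α`:
pairs `(x, t)` with `x > 0` and `log x ≥ t - α`. -/
def hypLog (α : ℝ) : Set (ℝ × ℝ) :=
  {p | 0 < p.1 ∧ p.2 - α ≤ Real.log p.1}

/-- The parametric exponential cone `K_exp(α)` with box parameter `M`: points `(x₁, x₂, x₃)` with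
`x₁, x₂ ∈ [1/M, M]` and `(x₁/x₂, x₃/x₂) ∈ hyp log(α)`. The coordinates are `x 0, x 1, x 2`. -/
def Kexp (M α : ℝ) : Set (Fin 3 → ℝ) :=
  {x | x 0 ∈ Set.Icc (1 / M) M ∧ x 1 ∈ Set.Icc (1 / M) M ∧
    (x 0 / x 1, x 2 / x 1) ∈ hypLog α}

/-- The Lorentz cone `L_{k+1} = {y ∈ ℝ^{k+1} : y_{k+1} ≥ √(y₁² + ⋯ + y_k²)}`. -/
def lorentzCone (k : ℕ) : Set (Fin (k + 1) → ℝ) :=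
  {y | Real.sqrt (∑ i : Fin k, y i.castSucc ^ 2) ≤ y (Fin.last k)}

/-- The data of `m` affine constraints in `n` real variables, each asking that three affine forms
lie in the three-dimensional Lorentz cone. -/
structure SOCSystem (n m : ℕ) where
  A₁ : Matrix (Fin m) (Fin n) ℝ
  A₂ : Matrix (Fin m) (Fin n) ℝ
  A₃ : Matrix (Fin m) (Fin n) ℝ
  b₁ : Fin m → ℝ
  b₂ : Fin m → ℝ
  b₃ : Fin m → ℝ

/-- The second-order conic set `K_sc(n, m)` in `ℝⁿ` defined by an SOC system. -/
def SOCSystem.feasible {n m : ℕ} (S : SOCSystem n m) : Set (Fin n → ℝ) :=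
  {z | ∀ i : Fin m,
    ![S.A₁.mulVec z i + S.b₁ i, S.A₂.mulVec z i + S.b₂ i, S.A₃.mulVec z i + S.b₃ i]
      ∈ lorentzCone 2}

/-- The subset of `ℝ³` described, in the extended space, by an SOC system in the three original
variables `x` and `p` additional variables `y`: the projection of its feasible set. -/
def SOCSystem.proj {p m : ℕ} (S : SOCSystem (3 + p) m) : Set (Fin 3 → ℝ) :=
  {x | ∃ y : Fin p → ℝ, Fin.append x y ∈ S.feasible}

/-- `S` describes an `ε`-accurate SOC approximation of the exponential cone with parameter `M`. -/
def IsSOCApprox (M ε : ℝ) {p m : ℕ} (S : SOCSystem (3 + p) m) : Prop :=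
  Kexp M (-ε) ⊆ S.proj ∧ S.proj ⊆ Kexp M ε

end ExpCone

/-! An approximation of accuracy at most one is one of accuracy one, so everything follows from
`IsSOCApprox.log_log_le`; `ε` enters only when dividing by a denominator that is bounded below. On
the slice `x₂ = 1`, the largest feasible `x₃` is within 1 of `log x₁`. With two squared slacks per
constraint, feasibility is the vanishing of a sum of squares `G` of degree at most 4 in `n = 1 + p +
2m` unknowns. Minimising `-x₃ + δ ∑ z_j ^ 6 + K G` gives stationarity equations that express each
`z_j ^ 5` by a polynomial of degree at most 4 (`exists_system_with_near_optimal_solutions`). Modulo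
these, polynomials of degree at most `2D` span at most `(2D + 1) 5 ^ n` dimensions, fewer than the
`(D + 1) ^ 2` monomials in `x₁, x₃` once `D = 2 * 5 ^ n`; hence a nonzero relation in `x₁, x₃`
(`exists_bivariate_relation`). No such relation can hold near the graph of the logarithm over a long
range (`coeff_eq_zero_of_vanish_near_log`): powers of `x₁` separate exponentially in `log x₁`, while
polynomials in `x₃` vary only polynomially. So `log M < 400 D ^ 3`, and `log log M = O(n)`. -/

namespace ExpCone

/-! ### Elimination by counting dimensions -/

open MvPolynomial in
/-- On a set where every `v (some j) ^ 5` agrees with a polynomial of degree at most four, each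
polynomial of degree at most `d` is a combination of the monomials of degree at most `d` in
the free variable and less than five in the others. -/
theorem eval_mem_span_of_pow_five_eq {σ : Type*} [Fintype σ] (V : Set (Option σ → ℝ))
    (g : σ → MvPolynomial (Option σ) ℝ) (hg : ∀ j, (g j).totalDegree ≤ 4)
    (hV : ∀ v ∈ V, ∀ j, v (some j) ^ 5 = eval v (g j)) (d : ℕ)
    (f : MvPolynomial (Option σ) ℝ) (hf : f.totalDegree ≤ d) :
    (fun v : V => eval v.1 f) ∈ Submodule.span ℝ
      (Set.range fun ab : Fin (d + 1) × (σ → Fin 5) => fun v : V =>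
        v.1 none ^ (ab.1 : ℕ) * ∏ j, v.1 (some j) ^ (ab.2 j : ℕ)) := by
  induction d using Nat.strong_induction_on generalizing f with
  | _ d ih =>
  have hmono : ∀ s : Option σ →₀ ℕ, (s.sum fun _ e => e) ≤ d →
      (fun v : V => eval v.1 (monomial s (1 : ℝ))) ∈ Submodule.span ℝ
      (Set.range fun ab : Fin (d + 1) × (σ → Fin 5) => fun v : V =>
        v.1 none ^ (ab.1 : ℕ) * ∏ j, v.1 (some j) ^ (ab.2 j : ℕ)) := by
    intro s hs
    by_cases h5 : ∀ j, s (some j) < 5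
    · apply Submodule.subset_span
      have h0 : s none ≤ d := by
        refine le_trans ?_ hs
        rw [Finsupp.sum_fintype _ _ (fun _ => rfl)]
        exact Finset.single_le_sum (f := fun i => s i) (fun _ _ => Nat.zero_le _)
          (Finset.mem_univ none)
      refine ⟨(⟨s none, by omega⟩, fun j => ⟨s (some j), h5 j⟩), ?_⟩
      funext v
      rw [eval_monomial, Finsupp.prod_fintype _ _ (fun _ => pow_zero _), Fintype.prod_option]
      simp
    · push Not at h5
      obtain ⟨j, hj⟩ := h5
      -- Trading a fifth power for `g j` lowers the degree by at least one, which drives the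
      -- induction.
      set s' : Option σ →₀ ℕ := s - Finsupp.single (some j) 5
      have hss : s = s' + Finsupp.single (some j) 5 := by
        refine (tsub_add_cancel_of_le ?_).symm
        rwa [Finsupp.single_le_iff]
      have hdeg : (s.sum fun _ e => e) = (s'.sum fun _ e => e) + 5 := by
        conv_lhs => rw [hss]
        rw [Finsupp.sum_add_index' (fun _ => rfl) (fun _ _ _ => rfl),
          Finsupp.sum_single_index rfl]
      have hlt : d - 1 < d := by omega
      have hd' : (g j * monomial s' (1 : ℝ)).totalDegree ≤ d - 1 := by
        have h1 := totalDegree_mul (g j) (monomial s' (1 : ℝ))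
        rw [totalDegree_monomial _ one_ne_zero] at h1
        have := hg j
        omega
      have hmem := ih (d - 1) hlt _ hd'
      have heq : (fun v : V => eval v.1 (monomial s (1 : ℝ))) =
          fun v : V => eval v.1 (g j * monomial s' (1 : ℝ)) := by
        funext v
        rw [map_mul, ← hV v.1 v.2 j]
        conv_lhs => rw [hss, ← one_mul (1 : ℝ), ← monomial_mul, map_mul]
        rw [mul_comm]
        simp [eval_monomial]
      rw [heq]
      refine Submodule.span_mono ?_ hmem
      rintro _ ⟨ab, rfl⟩
      exact ⟨(⟨ab.1, by have := ab.1.2; omega⟩, ab.2), rfl⟩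
  have hsum : (fun v : V => eval v.1 f) =
      ∑ s ∈ f.support, f.coeff s • fun v : V => eval v.1 (monomial s (1 : ℝ)) := by
    funext v
    conv_lhs => rw [f.as_sum, map_sum]
    simp [eval_monomial]
  rw [hsum]
  exact Submodule.sum_mem _ fun s hs =>
    Submodule.smul_mem _ _ (hmono s ((le_totalDegree hs).trans hf))

open MvPolynomial in
/-- Elimination: two coordinates are algebraically dependent on such a set, with a degree that is
single exponential in the number of variables. -/
theorem exists_bivariate_relation {σ : Type*} [Fintype σ] (V : Set (Option σ → ℝ))
    (g : σ → MvPolynomial (Option σ) ℝ) (hg : ∀ j, (g j).totalDegree ≤ 4)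
    (hV : ∀ v ∈ V, ∀ j, v (some j) ^ 5 = eval v (g j)) (k : σ) (D : ℕ)
    (hD : (2 * D + 1) * 5 ^ Fintype.card σ < (D + 1) ^ 2) :
    ∃ c : Fin (D + 1) → Fin (D + 1) → ℝ, (∃ i j, c i j ≠ 0) ∧
      ∀ v ∈ V, ∑ i, ∑ j, c i j * (v none ^ (i : ℕ) * v (some k) ^ (j : ℕ)) = 0 := by
  classical
  set B := fun ab : Fin (2 * D + 1) × (σ → Fin 5) => fun v : V =>
        v.1 none ^ (ab.1 : ℕ) * ∏ j, v.1 (some j) ^ (ab.2 j : ℕ)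
  set m := fun ij : Fin (D + 1) × Fin (D + 1) => fun v : V =>
        v.1 none ^ (ij.1 : ℕ) * v.1 (some k) ^ (ij.2 : ℕ)
  have hm : Set.range m ⊆ Submodule.span ℝ (Set.range B) := by
    rintro _ ⟨ij, rfl⟩
    have := eval_mem_span_of_pow_five_eq V g hg hV (2 * D)
      (X none ^ (ij.1 : ℕ) * X (some k) ^ (ij.2 : ℕ)) (by
        refine (totalDegree_mul _ _).trans ?_
        rw [totalDegree_X_pow, totalDegree_X_pow]
        have := ij.1.2
        have := ij.2.2
        omega)
    simpa using this
  have hnot : ¬ LinearIndependent ℝ m := by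
    intro hli
    have h1 := linearIndependent_le_span' m hli (Set.range B) hm
    have h2 : Fintype.card (Set.range B) ≤ (2 * D + 1) * 5 ^ Fintype.card σ := by
      refine (Fintype.card_range_le B).trans ?_
      simp
    rw [Cardinal.mk_fintype] at h1
    have h3 : Fintype.card (Fin (D + 1) × Fin (D + 1)) ≤ Fintype.card (Set.range B) := by
      exact_mod_cast h1
    simp only [Fintype.card_prod, Fintype.card_fin] at h3
    nlinarith
  obtain ⟨c, hc, ⟨⟨i, j⟩, hij⟩⟩ := Fintype.not_linearIndependent_iff.1 hnot
  refine ⟨fun i j => c (i, j), ⟨i, j, hij⟩, fun v hv => ?_⟩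
  have := congrFun hc ⟨v, hv⟩
  rw [Fintype.sum_prod_type] at this
  simpa [m] using this

end ExpCone

/-! ### Polynomial stationarity equations from penalised optimisation -/

namespace ExpCone

open Filter Topology

theorem totalDegree_pderiv_le {τ : Type*} (k : τ) (f : MvPolynomial τ ℝ) :
    (MvPolynomial.pderiv k f).totalDegree ≤ f.totalDegree := by
  classical
  conv_lhs => rw [f.as_sum, map_sum]
  refine MvPolynomial.totalDegree_finsetSum_le fun s hs => ?_
  rw [MvPolynomial.pderiv_monomial]
  refine (MvPolynomial.totalDegree_monomial_le _ _).trans ?_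
  refine le_trans ?_ (MvPolynomial.le_totalDegree hs)
  simp only [← Finsupp.degree_apply, Finsupp.sum]
  exact Finsupp.degree_mono tsub_le_self

theorem hasDerivAt_eval_update {τ : Type*} [DecidableEq τ] (k : τ) (f : MvPolynomial τ ℝ)
    (v : τ → ℝ) :
    HasDerivAt (fun t => MvPolynomial.eval (Function.update v k t) f)
      (MvPolynomial.eval v (MvPolynomial.pderiv k f)) (v k) := by
  induction f using MvPolynomial.induction_on with
  | C a => simpa using hasDerivAt_const (v k) a
  | add p q hp hq => simpa using hp.fun_add hq
  | mul_X p n hp =>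
    have hX : HasDerivAt (fun t => Function.update v k t n)
        (Pi.single (M := fun _ => ℝ) k 1 n) (v k) := by
      by_cases h : n = k
      · subst h
        simpa using hasDerivAt_id' (v n)
      · simpa [h] using hasDerivAt_const (v k) (v n)
    have := hp.mul hX
    simp only [Function.update_eq_self] at this
    convert! this using 1
    · funext t
      simp
    · rw [Derivation.leibniz, MvPolynomial.pderiv_X]
      by_cases h : n = k
      · subst h
        simp
        ring
      · simp [h]
        ring

/-- The regularised objective grows at infinity. -/
theorem tendsto_neg_add_sum_pow_six {σ : Type*} [Fintype σ] (k : σ) {δ : ℝ} (hδ : 0 < δ) :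
    Tendsto (fun z : σ → ℝ => -z k + δ * ∑ j, z j ^ 6) (cocompact (σ → ℝ)) atTop := by
  have h1 : Tendsto (fun r : ℝ => r * (δ * r ^ 5 - 1)) atTop atTop := by
    refine tendsto_id.atTop_mul_atTop₀ ?_
    exact tendsto_atTop_add_const_right _ _
      ((tendsto_pow_atTop (by norm_num)).const_mul_atTop hδ)
  refine tendsto_atTop_mono (fun z => ?_) (h1.comp tendsto_norm_cocompact_atTop)
  have : Nonempty σ := ⟨k⟩
  obtain ⟨i, hi⟩ := Finite.exists_max fun i => ‖z i‖
  have h2 : ‖z‖ ^ 6 ≤ ∑ j, z j ^ 6 := by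
    refine (pow_le_pow_left₀ (norm_nonneg z) ((pi_norm_le_iff_of_nonempty z).2 hi) 6).trans ?_
    rw [Real.norm_eq_abs, Even.pow_abs (by decide)]
    exact Finset.single_le_sum (f := fun j => z j ^ 6)
      (fun j _ => Even.pow_nonneg (by decide) _) (Finset.mem_univ i)
  have h3 : z k ≤ ‖z‖ := (le_abs_self _).trans (norm_le_pi_norm z k)
  have := mul_le_mul_of_nonneg_left h2 hδ.le
  simp only [Function.comp]
  nlinarith

/-- For a small regularisation and then a large penalty, the penalised problem has a minimiser
whose objective value is close to the optimal one. -/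
theorem eventually_exists_penalised_minimiser {σ : Type*} [Fintype σ] (k : σ)
    (γ : (σ → ℝ) → ℝ) (hγ : Continuous γ) (hγ0 : ∀ z, 0 ≤ γ z) (l h : ℝ)
    (hl : ∃ z, γ z = 0 ∧ l ≤ z k) (hh : ∀ z, γ z = 0 → z k ≤ h) :
    ∀ᶠ δ in 𝓝[>] (0 : ℝ), ∀ᶠ K in atTop, ∃ z : σ → ℝ, l - 1 ≤ z k ∧ z k ≤ h + 1 ∧
      ∀ w : σ → ℝ, (-z k + δ * ∑ j, z j ^ 6) + K * γ z ≤
        (-w k + δ * ∑ j, w j ^ 6) + K * γ w := by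
  obtain ⟨z₀, hz₀, hlz₀⟩ := hl
  set s := ∑ j, z₀ j ^ 6
  have hlim : Tendsto (fun δ : ℝ => δ * s) (𝓝[>] 0) (𝓝 0) := by
    have : Tendsto (fun δ : ℝ => δ * s) (𝓝 0) (𝓝 (0 * s)) := tendsto_id.mul_const s
    rw [zero_mul] at this
    exact this.mono_left nhdsWithin_le_nhds
  -- Small `δ`: the regulariser costs less than 1 at `z₀`, which is the loss allowed below `l`.
  filter_upwards [self_mem_nhdsWithin, hlim.eventually_lt_const one_pos] with δ hδ hδs
  have hδ : 0 < δ := hδ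
  set ψ : (σ → ℝ) → ℝ := fun z => -z k + δ * ∑ j, z j ^ 6
  have hψc : Continuous ψ := by fun_prop
  have hψt : Tendsto ψ (cocompact _) atTop := tendsto_neg_add_sum_pow_six k hδ
  obtain ⟨zb, hzb⟩ := hψc.exists_forall_le hψt
  have hS : IsCompact {z | ψ z ≤ ψ z₀ ∧ h + 1 ≤ z k} := by
    obtain ⟨t, ht, htS⟩ := mem_cocompact.1 (hψt.eventually_gt_atTop (ψ z₀))
    refine ht.of_isClosed_subset ?_ fun z hz => ?_
    · exact (isClosed_le hψc continuous_const).inter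
        (isClosed_le continuous_const (continuous_apply k))
    · by_contra hzt
      exact absurd hz.1 (not_le.2 (htS hzt))
  -- The competitive points that overshoot `h` by 1 form a compact set without zeros of `γ`, so `γ`
  -- has a positive lower bound there; a large `K` then rules them out.
  obtain ⟨g, hg, hgS⟩ : ∃ g > 0, ∀ z, ψ z ≤ ψ z₀ → h + 1 ≤ z k → g ≤ γ z := by
    rcases Set.eq_empty_or_nonempty {z | ψ z ≤ ψ z₀ ∧ h + 1 ≤ z k} with he | hne
    · refine ⟨1, one_pos, fun z h1 h2 => ?_⟩
      have : z ∈ {z | ψ z ≤ ψ z₀ ∧ h + 1 ≤ z k} := ⟨h1, h2⟩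
      rw [he] at this
      exact this.elim
    · obtain ⟨y, hy, hmin⟩ := hS.exists_isMinOn hne hγ.continuousOn
      refine ⟨γ y, (hγ0 y).lt_of_ne fun h0 => ?_, fun z h1 h2 => hmin ⟨h1, h2⟩⟩
      have := hh y h0.symm
      have := hy.2
      linarith
  filter_upwards [eventually_ge_atTop 0, eventually_gt_atTop ((ψ z₀ - ψ zb) / g)] with K hK0 hK
  have hΦt : Tendsto (fun z => ψ z + K * γ z) (cocompact _) atTop :=
    tendsto_atTop_mono (fun z => le_add_of_nonneg_right (mul_nonneg hK0 (hγ0 z))) hψt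
  have hΦc : Continuous fun z => ψ z + K * γ z := by fun_prop
  obtain ⟨z, hz⟩ := hΦc.exists_forall_le hΦt
  have h1 := hz z₀
  rw [hz₀, mul_zero, add_zero] at h1
  have hKz := mul_nonneg hK0 (hγ0 z)
  refine ⟨z, ?_, ?_, hz⟩
  · have h2 : 0 ≤ δ * ∑ j, z j ^ 6 :=
      mul_nonneg hδ.le (Finset.sum_nonneg fun j _ => Even.pow_nonneg (by decide) _)
    have h3 : ψ z ≤ -z₀ k + δ * s := by linarith
    have h4 : ψ z = -z k + δ * ∑ j, z j ^ 6 := rfl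
    linarith
  · by_contra! hlt
    have h2 := hgS z (by linarith) hlt.le
    have h3 := hzb z
    rw [div_lt_iff₀ hg] at hK
    have := mul_le_mul_of_nonneg_left h2 hK0
    linarith

open MvPolynomial in
/-- For a polynomial family of maximisation problems there is one polynomial system in
which the fifth power of each variable is expressed in lower degree and which has, at each parameter
of a given finite set, a solution that is optimal up to one. -/
theorem exists_system_with_near_optimal_solutions {σ : Type*} [Fintype σ]
    (G : MvPolynomial (Option σ) ℝ) (hG : G.totalDegree ≤ 4) (hG0 : ∀ v, 0 ≤ eval v G) (k : σ)
    (P : Finset ℝ) (l h : ℝ → ℝ)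
    (hl : ∀ x ∈ P, ∃ z : σ → ℝ, eval (fun o => o.elim x z) G = 0 ∧ l x ≤ z k)
    (hh : ∀ x ∈ P, ∀ z : σ → ℝ, eval (fun o => o.elim x z) G = 0 → z k ≤ h x) :
    ∃ g : σ → MvPolynomial (Option σ) ℝ, (∀ j, (g j).totalDegree ≤ 4) ∧
      ∀ x ∈ P, ∃ v : Option σ → ℝ, v none = x ∧ (∀ j, v (some j) ^ 5 = eval v (g j)) ∧
        l x - 1 ≤ v (some k) ∧ v (some k) ≤ h x + 1 := by
  classical
  have hev : ∀ᶠ δ in 𝓝[>] (0 : ℝ), ∀ x ∈ P, ∀ᶠ K in atTop, ∃ z : σ → ℝ,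
      l x - 1 ≤ z k ∧ z k ≤ h x + 1 ∧
      ∀ w : σ → ℝ, (-z k + δ * ∑ j, z j ^ 6) + K * eval (fun o => o.elim x z) G ≤
        (-w k + δ * ∑ j, w j ^ 6) + K * eval (fun o => o.elim x w) G := by
    refine (eventually_all_finset P).2 fun x hx => ?_
    have hc : Continuous fun z : σ → ℝ => eval (fun o : Option σ => o.elim x z) G := by
      refine (MvPolynomial.continuous_eval G).comp (continuous_pi fun o => ?_)
      cases o
      · exact continuous_const
      · exact continuous_apply _
    exact eventually_exists_penalised_minimiser k _ hc (fun z => hG0 _) _ _ (hl x hx) (hh x hx)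
  -- Finiteness of `P` allows one `δ`, then one `K`, for all parameters, hence a single system `g`.
  obtain ⟨δ, hδ, hδ0⟩ := (hev.and self_mem_nhdsWithin).exists
  have hδ0 : 0 < δ := hδ0
  obtain ⟨K, hK⟩ := ((eventually_all_finset P).2 hδ).exists
  -- This is the stationarity equation in direction `j` solved for the derivative `6 δ z_j ^ 5` of
  -- the regulariser.
  refine ⟨fun j => C (-(6 * δ)⁻¹) * pderiv (some j) (-X (some k) + C K * G), fun j => ?_,
    fun x hx => ?_⟩
  · refine (totalDegree_mul _ _).trans ?_
    rw [totalDegree_C, zero_add]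
    refine (totalDegree_pderiv_le _ _).trans ((totalDegree_add _ _).trans (max_le ?_ ?_))
    · rw [totalDegree_neg, totalDegree_X]
      norm_num
    · refine (totalDegree_mul _ _).trans ?_
      rwa [totalDegree_C, zero_add]
  · obtain ⟨z, hz1, hz2, hz⟩ := hK x hx
    refine ⟨fun o => o.elim x z, rfl, fun j => ?_, hz1, hz2⟩
    set v : Option σ → ℝ := fun o => o.elim x z
    set H : MvPolynomial (Option σ) ℝ := -X (some k) + C K * G
    set F : MvPolynomial (Option σ) ℝ := H + C δ * ∑ i, X (some i) ^ 6
    have hFe : ∀ w : σ → ℝ, eval (fun o => o.elim x w) F =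
        (-w k + δ * ∑ j, w j ^ 6) + K * eval (fun o => o.elim x w) G := by
      intro w
      simp [F, H]
      ring
    have hupd : ∀ t, Function.update v (some j) t =
        fun o : Option σ => o.elim x (Function.update z j t) := by
      intro t
      funext o
      cases o with
      | none => simp [v]
      | some i =>
        by_cases hij : i = j
        · subst hij
          simp
        · simp [hij, v]
    have hmin : IsLocalMin (fun t => eval (Function.update v (some j) t) F) (v (some j)) := by
      refine Filter.Eventually.of_forall fun t => ?_
      simp only [Function.update_eq_self]
      rw [hupd t, hFe, hFe]
      exact hz _
    have h0 := hmin.hasDerivAt_eq_zero (hasDerivAt_eval_update (some j) F v)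
    have hsum : pderiv (some j) (∑ i, X (some i) ^ 6 : MvPolynomial (Option σ) ℝ) =
        6 * X (some j) ^ 5 := by
      rw [map_sum, Finset.sum_eq_single j]
      · simp [Derivation.leibniz_pow]
      · intro i _ hij
        simp [Derivation.leibniz_pow, pderiv_X, hij]
      · simp
    have hF' : pderiv (some j) F = pderiv (some j) H + C δ * (6 * X (some j) ^ 5) := by
      simp only [F, map_add, pderiv_C_mul, hsum]
    rw [hF'] at h0
    simp only [map_add, map_mul, eval_C, map_pow, eval_X, map_ofNat] at h0
    rw [map_mul, eval_C]
    field_simp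
    linarith

end ExpCone

/-! ### No low-degree relation near the graph of the logarithm -/

namespace ExpCone

open Polynomial in
/-- Growth of a polynomial that is bounded on separated nodes. -/
theorem abs_eval_le_of_separated_nodes {D : ℕ} (f : ℝ[X]) (hf : f.degree < (D + 1 : ℕ))
    (u : Fin (D + 1) → ℝ) (hu : ∀ b b', b ≠ b' → 1 ≤ |u b - u b'|) {y R B : ℝ}
    (hy : ∀ b, |y - u b| ≤ R) (hB : ∀ b, |f.eval (u b)| ≤ B) :
    |f.eval y| ≤ (D + 1) * R ^ D * B := by
  have hinj : Set.InjOn u (Finset.univ : Finset (Fin (D + 1))) := by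
    intro b _ b' _ h
    by_contra hne
    have := hu b b' hne
    rw [h, sub_self, abs_zero] at this
    linarith
  have hR : 0 ≤ R := (abs_nonneg _).trans (hy 0)
  have hB0 : 0 ≤ B := (abs_nonneg _).trans (hB 0)
  rw [Lagrange.eq_interpolate (f := f) hinj (by simpa using hf), Lagrange.interpolate_apply,
    eval_finsetSum]
  refine (Finset.abs_sum_le_sum_abs _ _).trans ?_
  have hterm : ∀ b ∈ (Finset.univ : Finset (Fin (D + 1))),
      |(C (f.eval (u b)) * Lagrange.basis Finset.univ u b).eval y| ≤ R ^ D * B := by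
    intro b _
    rw [eval_mul, eval_C, abs_mul, Lagrange.basis, eval_prod, Finset.abs_prod, mul_comm]
    refine mul_le_mul ?_ (hB b) (abs_nonneg _) (pow_nonneg hR _)
    refine (Finset.prod_le_prod (g := fun _ => R) (fun _ _ => abs_nonneg _) ?_).trans_eq
      (by simp)
    intro b' hb'
    have h1 := hu b b' (Finset.ne_of_mem_erase hb').symm
    rw [Lagrange.basisDivisor, eval_mul, eval_C, eval_sub, eval_X, eval_C, abs_mul, abs_inv]
    calc |u b - u b'|⁻¹ * |y - u b'| ≤ 1 * R :=
          mul_le_mul (inv_le_one_of_one_le₀ h1) (hy b') (abs_nonneg _) zero_le_one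
      _ = R := one_mul R
  refine (Finset.sum_le_card_nsmul _ _ _ hterm).trans (le_of_eq ?_)
  simp [mul_assoc]

/-- Among `2 D + 3` equally spaced scales, one dominant monomial of a polynomial of degree `D` is
larger than all others by a full factor. -/
theorem exists_dominant_monomial (D : ℕ) (w : Fin (D + 1) → ℝ) (hw : ∀ i, 0 ≤ w i)
    (hpos : ∃ i, 0 < w i) {L : ℝ} (hL : 0 < L) :
    ∃ a : ℕ, a ≤ 2 * D + 2 ∧ ∃ i, 0 < w i ∧ ∀ i', i' ≠ i →
      w i' * Real.exp (i' * (a * L)) ≤ Real.exp (-L) * (w i * Real.exp (i * (a * L))) := by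
  obtain ⟨i₀, hi₀⟩ := hpos
  have hmax : ∀ a : ℕ, ∃ i : Fin (D + 1), ∀ i' : Fin (D + 1),
      w i' * Real.exp (i' * (a * L)) ≤ w i * Real.exp (i * (a * L)) :=
    fun a => Finite.exists_max fun i : Fin (D + 1) => w i * Real.exp (i * (a * L))
  choose I hI using hmax
  have hIpos : ∀ a, 0 < w (I a) := by
    intro a
    have h1 := (mul_pos hi₀ (Real.exp_pos _)).trans_le (hI a i₀)
    exact pos_of_mul_pos_left h1 (Real.exp_pos _).le
  -- Raising the scale favours larger exponents, so the maximising index can only move up.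
  have hmono : ∀ a, I a ≤ I (a + 1) := by
    intro a
    by_contra! hlt
    have hlt' : ((I (a + 1) : ℕ) : ℝ) < (I a : ℕ) := by exact_mod_cast hlt
    have h1 := hI a (I (a + 1))
    have h2 := hI (a + 1) (I a)
    have h3 := mul_le_mul_of_nonneg_right h1 (Real.exp_pos ((I a : ℕ) * L)).le
    rw [mul_assoc, mul_assoc, ← Real.exp_add, ← Real.exp_add] at h3
    have h4 : w (I (a + 1)) * Real.exp ((I (a + 1) : ℕ) * (((a + 1 : ℕ) : ℝ) * L)) <
        w (I (a + 1)) * Real.exp ((I (a + 1) : ℕ) * (a * L) + (I a : ℕ) * L) := by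
      refine mul_lt_mul_of_pos_left (Real.exp_lt_exp.2 ?_) (hIpos _)
      push_cast
      nlinarith
    have h5 : ((I a : ℕ) : ℝ) * (((a + 1 : ℕ) : ℝ) * L) =
        (I a : ℕ) * (a * L) + (I a : ℕ) * L := by
      push_cast
      ring
    rw [h5] at h2
    linarith
  -- Pigeonhole: `D + 2` even scales, `D + 1` indices. At the scale in between, the lower neighbour
  -- gives the factor `exp (-L)` against smaller exponents, the upper one against larger exponents.
  obtain ⟨k, hk, hkI⟩ : ∃ k ≤ D, I (2 * k) = I (2 * k + 2) := by
    by_contra! hne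
    have hge : ∀ k ≤ D + 1, k ≤ (I (2 * k) : ℕ) := by
      intro k
      induction k with
      | zero => exact fun _ => Nat.zero_le _
      | succ k ih =>
        intro hk
        have h1 := ih (by omega)
        have h2 : I (2 * k) < I (2 * k + 2) :=
          lt_of_le_of_ne ((hmono _).trans (hmono _)) (hne k (by omega))
        have h3 : (I (2 * k) : ℕ) < I (2 * k + 2) := h2
        have h4 : 2 * (k + 1) = 2 * k + 2 := by ring
        rw [h4]
        omega
    have := hge (D + 1) le_rfl
    have := (I (2 * (D + 1))).2
    omega
  have hk1 : I (2 * k + 1) = I (2 * k) :=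
    le_antisymm ((hmono (2 * k + 1)).trans hkI.ge) (hmono _)
  refine ⟨2 * k + 1, by omega, I (2 * k), hIpos _, fun i' hi' => ?_⟩
  set i := I (2 * k)
  have hlow := hI (2 * k) i'
  have hhigh := hI (2 * k + 2) i'
  rw [← hkI] at hhigh
  have key : ∀ (s : ℝ) (e : ℝ), w i' * Real.exp (i' * s) ≤ w i * Real.exp (i * s) →
      ((2 * k + 1 : ℕ) : ℝ) * L = s + e → ((i' : ℕ) - (i : ℕ) : ℝ) * e ≤ -L →
      w i' * Real.exp (i' * (((2 * k + 1 : ℕ) : ℝ) * L)) ≤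
        Real.exp (-L) * (w i * Real.exp (i * (((2 * k + 1 : ℕ) : ℝ) * L))) := by
    intro s e h1 h2 h3
    rw [h2]
    have h4 := mul_le_mul_of_nonneg_right h1 (Real.exp_pos ((i' : ℕ) * e)).le
    rw [mul_assoc, mul_assoc, ← Real.exp_add, ← Real.exp_add, ← mul_add] at h4
    refine h4.trans ?_
    rw [mul_left_comm, ← Real.exp_add]
    refine mul_le_mul_of_nonneg_left (Real.exp_le_exp.2 ?_) (hw i)
    linarith
  rcases lt_or_gt_of_ne hi' with hlt | hgt
  · have h1 : ((i' : ℕ) : ℝ) + 1 ≤ (i : ℕ) := by exact_mod_cast hlt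
    refine key _ L hlow (by push_cast; ring) ?_
    nlinarith
  · have h1 : ((i : ℕ) : ℝ) + 1 ≤ (i' : ℕ) := by exact_mod_cast hgt
    refine key _ (-L) hhigh (by push_cast; ring) ?_
    nlinarith

/-- This fixes the scale gap `100 D ^ 2`. The base of the `D`-th power is at most `exp (6 + 3D)`, so
the left side is at most `exp (15D + 11D ^ 2)`. -/
theorem dominance_constant_lt {D : ℕ} (hD : 2 ≤ D) :
    ((D + 1) * ((2 * D + 2) * (100 * (D : ℝ) ^ 2) + 5 * D + 4) ^ D) ^ 2 * Real.exp (5 * D ^ 2) *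
      (D + 1) < Real.exp (100 * (D : ℝ) ^ 2) := by
  have hD' : (2 : ℝ) ≤ D := by exact_mod_cast hD
  set d : ℝ := (D : ℝ)
  have h1 : d + 1 ≤ Real.exp d := Real.add_one_le_exp d
  have h6 : (400 : ℝ) ≤ Real.exp 6 := by
    have h := Real.exp_one_gt_d9
    have h2 : Real.exp 6 = Real.exp 1 ^ 6 := by rw [← Real.exp_nat_mul]; norm_num
    rw [h2]
    refine le_trans ?_ (pow_le_pow_left₀ (by norm_num) h.le 6)
    norm_num
  have hd : d ^ 3 ≤ Real.exp (3 * d) := by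
    have : Real.exp (3 * d) = Real.exp d ^ 3 := by rw [← Real.exp_nat_mul]; norm_num
    rw [this]
    exact pow_le_pow_left₀ (by linarith) (by linarith) 3
  have hR : (2 * d + 2) * (100 * d ^ 2) + 5 * d + 4 ≤ Real.exp (6 + 3 * d) := by
    rw [Real.exp_add]
    calc (2 * d + 2) * (100 * d ^ 2) + 5 * d + 4 ≤ 400 * d ^ 3 := by
          nlinarith [mul_nonneg (sq_nonneg d) (sub_nonneg.2 hD'),
            mul_nonneg (by linarith : 0 ≤ d) (sub_nonneg.2 hD')]
      _ ≤ _ := mul_le_mul h6 hd (by positivity) (Real.exp_pos _).le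
  have hR0 : 0 ≤ (2 * d + 2) * (100 * d ^ 2) + 5 * d + 4 := by positivity
  calc ((d + 1) * ((2 * d + 2) * (100 * d ^ 2) + 5 * d + 4) ^ D) ^ 2 * Real.exp (5 * d ^ 2) *
      (d + 1) ≤ (Real.exp d * Real.exp (6 + 3 * d) ^ D) ^ 2 * Real.exp (5 * d ^ 2) *
        Real.exp d := by gcongr
    _ = Real.exp (15 * d + 11 * d ^ 2) := by
        rw [← Real.exp_nat_mul, ← Real.exp_add, ← Real.exp_nat_mul, ← Real.exp_add,
          ← Real.exp_add]
        congr 1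
        push_cast
        ring
    _ < Real.exp (100 * d ^ 2) := Real.exp_lt_exp.2 (by nlinarith)

open Polynomial in
/-- A bivariate polynomial of degree at most `D` in each variable that vanishes at points close to
the graph of the logarithm, suitably spread over a range of length polynomial in `D`, is zero. -/
theorem coeff_eq_zero_of_vanish_near_log {D : ℕ} (hD : 2 ≤ D) (c : Fin (D + 1) → Fin (D + 1) → ℝ)
    (y : ℕ → Fin (D + 1) → ℝ)
    (hy : ∀ a ≤ 2 * D + 2, ∀ b, |y a b - (a * (100 * (D : ℝ) ^ 2) + 5 * (b : ℕ))| ≤ 2)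
    (h0 : ∀ a ≤ 2 * D + 2, ∀ b : Fin (D + 1), ∑ i, ∑ j, c i j *
      (Real.exp (a * (100 * (D : ℝ) ^ 2) + 5 * (b : ℕ)) ^ (i : ℕ) * y a b ^ (j : ℕ)) = 0) :
    ∀ i j, c i j = 0 := by
  set L : ℝ := 100 * (D : ℝ) ^ 2
  have hD' : (2 : ℝ) ≤ D := by exact_mod_cast hD
  have hL : 0 < L := by positivity
  set Q : Fin (D + 1) → ℝ[X] := fun i => ∑ j : Fin (D + 1), C (c i j) * X ^ (j : ℕ)
  have hQdeg : ∀ i, (Q i).degree < (D + 1 : ℕ) := fun i => degree_sum_fin_lt _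
  have hQeval : ∀ i t, (Q i).eval t = ∑ j, c i j * t ^ (j : ℕ) := by
    intro i t
    simp [Q, eval_finsetSum]
  set R : ℝ := (2 * D + 2) * L + 5 * D + 4
  set G : ℝ := (D + 1) * R ^ D
  have hG : 0 < G := by positivity
  -- Nodes 5 apart, each displaced by at most 2, stay at distance at least `5 - 2 * 2 = 1`.
  have hsep : ∀ a ≤ 2 * D + 2, ∀ b b', b ≠ b' → 1 ≤ |y a b - y a b'| := by
    have key : ∀ a ≤ 2 * D + 2, ∀ b b', b < b' → 1 ≤ y a b' - y a b := by
      intro a ha b b' hlt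
      have h1 := abs_le.1 (hy a ha b)
      have h2 := abs_le.1 (hy a ha b')
      have h3 : ((b : ℕ) : ℝ) + 1 ≤ (b' : ℕ) := by exact_mod_cast hlt
      linarith [h1.2, h2.1]
    intro a ha b b' hne
    rcases lt_or_gt_of_ne hne with hlt | hgt
    · rw [abs_sub_comm]
      exact (key a ha b b' hlt).trans (le_abs_self _)
    · exact (key a ha b' b hgt).trans (le_abs_self _)
  have hrange : ∀ a ≤ 2 * D + 2, ∀ b, -2 ≤ y a b ∧ y a b ≤ (2 * D + 2) * L + 5 * D + 2 := by
    intro a ha b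
    have h1 := abs_le.1 (hy a ha b)
    have h2 : ((b : ℕ) : ℝ) ≤ D := by exact_mod_cast Nat.lt_succ_iff.1 b.2
    have h3 : (a : ℝ) ≤ 2 * D + 2 := by exact_mod_cast ha
    have h4 := mul_le_mul_of_nonneg_right h3 hL.le
    have h5 : 0 ≤ (a : ℝ) * L := by positivity
    have h6 : (0 : ℝ) ≤ (b : ℕ) := Nat.cast_nonneg _
    exact ⟨by linarith [h1.1], by linarith [h1.2]⟩
  have hcomp : ∀ a ≤ 2 * D + 2, ∀ a' ≤ 2 * D + 2, ∀ i B, (∀ b, |(Q i).eval (y a b)| ≤ B) →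
      ∀ b, |(Q i).eval (y a' b)| ≤ G * B := by
    intro a ha a' ha' i B hB b
    refine abs_eval_le_of_separated_nodes (Q i) (hQdeg i) (y a) (hsep a ha) (fun b' => ?_) hB
    have h1 := hrange a ha b'
    have h2 := hrange a' ha' b
    exact abs_le.2 ⟨by linarith [h1.2, h2.1], by linarith [h1.1, h2.2]⟩
  -- The size of `Q i` is measured at scale 0; by interpolation its maximum over the nodes of any
  -- other scale agrees with this up to the factor `G`.
  set n : Fin (D + 1) → ℝ := fun i => ‖fun b => (Q i).eval (y 0 b)‖
  have hn0 : ∀ i, 0 ≤ n i := fun i => norm_nonneg _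
  have hA : ∀ a ≤ 2 * D + 2, ∀ i b, |(Q i).eval (y a b)| ≤ G * n i := fun a ha i =>
    hcomp 0 (Nat.zero_le _) a ha i (n i) fun b =>
      norm_le_pi_norm (fun b => (Q i).eval (y 0 b)) b
  have hB : ∀ a ≤ 2 * D + 2, ∀ i, ∃ b, n i ≤ G * |(Q i).eval (y a b)| := by
    intro a ha i
    obtain ⟨b, hb⟩ := Finite.exists_max fun b => |(Q i).eval (y a b)|
    exact ⟨b, (pi_norm_le_iff_of_nonempty _).2
      fun b' => hcomp a ha 0 (Nat.zero_le _) i _ hb b'⟩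
  by_contra! hne
  obtain ⟨i₁, j₁, hc⟩ := hne
  have hpos : ∃ i, 0 < n i := by
    refine ⟨i₁, (hn0 i₁).lt_of_ne fun h => hc ?_⟩
    have hz : (fun b => (Q i₁).eval (y 0 b)) = 0 := norm_eq_zero.1 h.symm
    have hinj : Set.InjOn (y 0) (Finset.univ : Finset (Fin (D + 1))) := by
      intro b _ b' _ hbb
      by_contra hne
      have := hsep 0 (Nat.zero_le _) b b' hne
      rw [hbb, sub_self, abs_zero] at this
      linarith
    have hQ0 : Q i₁ = 0 := Polynomial.eq_zero_of_degree_lt_of_eval_index_eq_zero _ hinj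
      (by simpa using hQdeg i₁) fun b _ => congrFun hz b
    have := congrArg (fun q => q.coeff (j₁ : ℕ)) hQ0
    simpa [Q, finsetSum_coeff, coeff_X_pow, Fin.val_inj] using this
  -- At this scale the term of index `i` beats the sum of all others at a node where `Q i` is large,
  -- so the relation fails.
  obtain ⟨a, ha, i, hi, hdom⟩ := exists_dominant_monomial D n hn0 hpos hL
  obtain ⟨b, hb⟩ := hB a ha i
  set x : ℝ := Real.exp (a * L + 5 * (b : ℕ))
  have hb2 : ((b : ℕ) : ℝ) ≤ D := by exact_mod_cast Nat.lt_succ_iff.1 b.2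
  have hxpow : ∀ i' : Fin (D + 1),
      x ^ (i' : ℕ) = Real.exp (i' * (a * L)) * Real.exp (i' * (5 * (b : ℕ))) := by
    intro i'
    rw [← Real.exp_nat_mul, mul_add, Real.exp_add]
  have hrel : x ^ (i : ℕ) * (Q i).eval (y a b) =
      -∑ i' ∈ Finset.univ.erase i, x ^ (i' : ℕ) * (Q i').eval (y a b) := by
    rw [eq_neg_iff_add_eq_zero, Finset.add_sum_erase _ (fun i' : Fin (D + 1) => x ^ (i' : ℕ) * (Q i').eval (y a b))
      (Finset.mem_univ i), ← h0 a ha b]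
    refine Finset.sum_congr rfl fun i' _ => ?_
    rw [hQeval, Finset.mul_sum]
    exact Finset.sum_congr rfl fun j _ => by ring
  have hterm : ∀ i' ∈ Finset.univ.erase i, |x ^ (i' : ℕ) * (Q i').eval (y a b)| ≤
      G * Real.exp (5 * D ^ 2) * (Real.exp (-L) * (n i * Real.exp (i * (a * L)))) := by
    intro i' hi'
    have h1 := hdom i' (Finset.ne_of_mem_erase hi')
    have h2 := hA a ha i' b
    have h3 : Real.exp (i' * (5 * (b : ℕ))) ≤ Real.exp (5 * D ^ 2) := by
      refine Real.exp_le_exp.2 ?_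
      have h4 : ((i' : ℕ) : ℝ) ≤ D := by exact_mod_cast Nat.lt_succ_iff.1 i'.2
      have := mul_le_mul h4 hb2 (Nat.cast_nonneg _) (Nat.cast_nonneg _)
      nlinarith
    rw [abs_mul, abs_of_nonneg (by positivity : (0 : ℝ) ≤ x ^ (i' : ℕ)), hxpow]
    calc _ ≤ Real.exp (i' * (a * L)) * Real.exp (5 * D ^ 2) * (G * n i') := by gcongr
      _ = G * Real.exp (5 * D ^ 2) * (n i' * Real.exp (i' * (a * L))) := by ring
      _ ≤ _ := by gcongr
  have hsum : x ^ (i : ℕ) * |(Q i).eval (y a b)| ≤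
      D * (G * Real.exp (5 * D ^ 2) * (Real.exp (-L) * (n i * Real.exp (i * (a * L))))) := by
    rw [← abs_of_nonneg (by positivity : (0 : ℝ) ≤ x ^ (i : ℕ)), ← abs_mul, hrel, abs_neg]
    refine (Finset.abs_sum_le_sum_abs _ _).trans
      ((Finset.sum_le_card_nsmul _ _ _ hterm).trans (le_of_eq ?_))
    simp
  have hxi : Real.exp (i * (a * L)) ≤ x ^ (i : ℕ) := by
    rw [hxpow]
    exact le_mul_of_one_le_right (Real.exp_pos _).le (Real.one_le_exp (by positivity))
  set E := n i * Real.exp (i * (a * L))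
  have hE : 0 < E := mul_pos hi (Real.exp_pos _)
  have hfin : E ≤ E * (G ^ 2 * Real.exp (5 * D ^ 2) * (D + 1) * Real.exp (-L)) := by
    calc E ≤ G * |(Q i).eval (y a b)| * x ^ (i : ℕ) := by
          exact mul_le_mul hb hxi (Real.exp_pos _).le (by positivity)
      _ = G * (x ^ (i : ℕ) * |(Q i).eval (y a b)|) := by ring
      _ ≤ G * ((D + 1) * (G * Real.exp (5 * D ^ 2) * (Real.exp (-L) * E))) := by
          refine mul_le_mul_of_nonneg_left (hsum.trans ?_) hG.le
          gcongr
          linarith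
      _ = _ := by ring
  have hlt : G ^ 2 * Real.exp (5 * D ^ 2) * (D + 1) * Real.exp (-L) < 1 := by
    rw [Real.exp_neg, ← div_eq_mul_inv, div_lt_one (Real.exp_pos _)]
    exact dominance_constant_lt hD
  nlinarith

end ExpCone

/-! ### SOC systems on the slice and the size bound -/

namespace ExpCone

open MvPolynomial

/-- The coordinates of the ambient space of an SOC system on the slice `x₂ = 1`, as polynomials:
the parameter is `x₁` and the variables are `x₃`, the additional variables and two slack
variables for each constraint. -/
noncomputable def sliceCoord (p m : ℕ) :
    Fin (3 + p) → MvPolynomial (Option (Unit ⊕ Fin p ⊕ Fin m ⊕ Fin m)) ℝ :=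
  Fin.append ![X none, 1, X (some (.inl ()))] fun j => X (some (.inr (.inl j)))

/-- An affine form on the slice `x₂ = 1`, as a polynomial. -/
noncomputable def sliceForm {p m : ℕ} (A : Matrix (Fin m) (Fin (3 + p)) ℝ) (b : Fin m → ℝ)
    (i : Fin m) : MvPolynomial (Option (Unit ⊕ Fin p ⊕ Fin m ⊕ Fin m)) ℝ :=
  ∑ j, C (A i j) * sliceCoord p m j + C (b i)

/-- The sum of squared residuals of an SOC system on the slice `x₂ = 1`, written as quadratic
equations with slack variables. -/
noncomputable def SOCSystem.residual {p m : ℕ} (S : SOCSystem (3 + p) m) :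
    MvPolynomial (Option (Unit ⊕ Fin p ⊕ Fin m ⊕ Fin m)) ℝ :=
  ∑ i, ((sliceForm S.A₃ S.b₃ i - X (some (.inr (.inr (.inl i)))) ^ 2) ^ 2 +
    (sliceForm S.A₃ S.b₃ i ^ 2 - sliceForm S.A₁ S.b₁ i ^ 2 - sliceForm S.A₂ S.b₂ i ^ 2
      - X (some (.inr (.inr (.inr i)))) ^ 2) ^ 2)

theorem eval_sliceForm {p m : ℕ} (A : Matrix (Fin m) (Fin (3 + p)) ℝ) (b : Fin m → ℝ) (i : Fin m)
    (v : Option (Unit ⊕ Fin p ⊕ Fin m ⊕ Fin m) → ℝ) :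
    eval v (sliceForm A b i) = A.mulVec (Fin.append ![v none, 1, v (some (.inl ()))]
      fun j => v (some (.inr (.inl j)))) i + b i := by
  simp only [sliceForm, map_add, map_sum, map_mul, eval_C, Matrix.mulVec, dotProduct]
  congr 1
  refine Finset.sum_congr rfl fun j _ => ?_
  congr 1
  refine Fin.addCases (fun k => ?_) (fun k => ?_) j
  · rw [sliceCoord, Fin.append_left, Fin.append_left]
    fin_cases k <;> simp
  · rw [sliceCoord, Fin.append_right, Fin.append_right, eval_X]

theorem totalDegree_sliceForm_le {p m : ℕ} (A : Matrix (Fin m) (Fin (3 + p)) ℝ) (b : Fin m → ℝ)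
    (i : Fin m) : (sliceForm A b i).totalDegree ≤ 1 := by
  refine (totalDegree_add _ _).trans (max_le ?_ (by simp))
  refine totalDegree_finsetSum_le fun j _ => (totalDegree_mul _ _).trans ?_
  rw [totalDegree_C, zero_add]
  refine Fin.addCases (fun k => ?_) (fun k => ?_) j
  · rw [sliceCoord, Fin.append_left]
    fin_cases k <;> simp
  · rw [sliceCoord, Fin.append_right, totalDegree_X]

theorem SOCSystem.totalDegree_residual_le {p m : ℕ} (S : SOCSystem (3 + p) m) :
    S.residual.totalDegree ≤ 4 := by
  have hsub : ∀ (f g : MvPolynomial (Option (Unit ⊕ Fin p ⊕ Fin m ⊕ Fin m)) ℝ),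
      f.totalDegree ≤ 2 → g.totalDegree ≤ 2 → (f - g).totalDegree ≤ 2 := fun f g hf hg =>
    (totalDegree_sub _ _).trans (max_le hf hg)
  have hsq : ∀ (f : MvPolynomial (Option (Unit ⊕ Fin p ⊕ Fin m ⊕ Fin m)) ℝ) (d : ℕ),
      f.totalDegree ≤ d → (f ^ 2).totalDegree ≤ 2 * d := fun f d hf =>
    (totalDegree_pow _ _).trans (Nat.mul_le_mul_left 2 hf)
  have hX : ∀ s, ((X s : MvPolynomial (Option (Unit ⊕ Fin p ⊕ Fin m ⊕ Fin m)) ℝ) ^ 2).totalDegree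
      ≤ 2 := fun s => (totalDegree_X_pow s 2).le
  have hF := fun A b i => totalDegree_sliceForm_le (p := p) (m := m) A b i
  have hF2 := fun A b i => hsq _ 1 (hF A b i)
  refine totalDegree_finsetSum_le fun i _ => (totalDegree_add _ _).trans (max_le ?_ ?_)
  · exact hsq _ 2 (hsub _ _ ((hF _ _ _).trans one_le_two) (hX _))
  · exact hsq _ 2 (hsub _ _ (hsub _ _ (hsub _ _ (hF2 _ _ _) (hF2 _ _ _)) (hF2 _ _ _)) (hX _))

theorem SOCSystem.eval_residual_nonneg {p m : ℕ} (S : SOCSystem (3 + p) m)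
    (v : Option (Unit ⊕ Fin p ⊕ Fin m ⊕ Fin m) → ℝ) : 0 ≤ eval v S.residual := by
  simp only [residual, map_sum, map_add, map_pow]
  positivity

theorem mem_lorentzCone_two_iff (a b c : ℝ) :
    ![a, b, c] ∈ lorentzCone 2 ↔ 0 ≤ c ∧ a ^ 2 + b ^ 2 ≤ c ^ 2 := by
  simp only [lorentzCone, Set.mem_ofPred_eq, Fin.sum_univ_two]
  exact Real.sqrt_le_iff

theorem SOCSystem.eval_residual_eq_zero_iff {p m : ℕ} (S : SOCSystem (3 + p) m)
    (v : Option (Unit ⊕ Fin p ⊕ Fin m ⊕ Fin m) → ℝ) :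
    eval v S.residual = 0 ↔ ∀ i,
      eval v (sliceForm S.A₃ S.b₃ i) = v (some (.inr (.inr (.inl i)))) ^ 2 ∧
      eval v (sliceForm S.A₃ S.b₃ i) ^ 2 - eval v (sliceForm S.A₁ S.b₁ i) ^ 2 -
        eval v (sliceForm S.A₂ S.b₂ i) ^ 2 = v (some (.inr (.inr (.inr i)))) ^ 2 := by
  simp only [residual, map_sum, map_add, map_sub, map_pow, eval_X]
  rw [Finset.sum_eq_zero_iff_of_nonneg fun i _ => by positivity]
  simp only [Finset.mem_univ, true_imp_iff]
  refine forall_congr' fun i => ?_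
  rw [add_eq_zero_iff_of_nonneg (sq_nonneg _) (sq_nonneg _), sq_eq_zero_iff, sq_eq_zero_iff,
    sub_eq_zero, sub_eq_zero]

theorem SOCSystem.mem_proj_of_eval_residual_eq_zero {p m : ℕ} (S : SOCSystem (3 + p) m)
    (v : Option (Unit ⊕ Fin p ⊕ Fin m ⊕ Fin m) → ℝ) (hv : eval v S.residual = 0) :
    ![v none, 1, v (some (.inl ()))] ∈ S.proj := by
  refine ⟨fun j => v (some (.inr (.inl j))), fun i => ?_⟩
  rw [← eval_sliceForm, ← eval_sliceForm, ← eval_sliceForm, mem_lorentzCone_two_iff]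
  obtain ⟨h1, h2⟩ := (S.eval_residual_eq_zero_iff v).1 hv i
  have := sq_nonneg (v (some (.inr (.inr (.inr i)))))
  exact ⟨by rw [h1]; positivity, by linarith⟩

theorem SOCSystem.exists_eval_residual_eq_zero {p m : ℕ} (S : SOCSystem (3 + p) m) {x t : ℝ}
    (h : ![x, 1, t] ∈ S.proj) : ∃ z : (Unit ⊕ Fin p ⊕ Fin m ⊕ Fin m) → ℝ,
      eval (fun o => o.elim x z) S.residual = 0 ∧ z (.inl ()) = t := by
  obtain ⟨y, hy⟩ := h
  set w := Fin.append ![x, 1, t] y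
  refine ⟨Sum.elim (fun _ => t) (Sum.elim y (Sum.elim
    (fun i => Real.sqrt (S.A₃.mulVec w i + S.b₃ i))
    (fun i => Real.sqrt ((S.A₃.mulVec w i + S.b₃ i) ^ 2 - (S.A₁.mulVec w i + S.b₁ i) ^ 2 -
      (S.A₂.mulVec w i + S.b₂ i) ^ 2)))), (S.eval_residual_eq_zero_iff _).2 fun i => ?_, rfl⟩
  obtain ⟨h1, h2⟩ := (mem_lorentzCone_two_iff _ _ _).1 (hy i)
  have h3 : 0 ≤ (S.A₃.mulVec w i + S.b₃ i) ^ 2 - (S.A₁.mulVec w i + S.b₁ i) ^ 2 -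
      (S.A₂.mulVec w i + S.b₂ i) ^ 2 := by linarith
  simp only [eval_sliceForm]
  exact ⟨(Real.sq_sqrt h1).symm, (Real.sq_sqrt h3).symm⟩

/-- The range of an SOC approximation of accuracy one is at most double exponential in its size. -/
theorem log_lt_of_isSOCApprox_one {M : ℝ} (hM : 1 < M) {p m : ℕ} (S : SOCSystem (3 + p) m)
    (hS : IsSOCApprox M 1 S) {D : ℕ} (hD : D = 2 * 5 ^ (1 + p + 2 * m)) :
    Real.log M < 400 * (D : ℝ) ^ 3 := by
  by_contra! hlog
  have hM0 : 0 < M := zero_lt_one.trans hM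
  have h5 : 1 ≤ 5 ^ (1 + p + 2 * m) := Nat.one_le_pow _ _ (by norm_num)
  have hD2 : 2 ≤ D := by omega
  have hD2' : (2 : ℝ) ≤ D := by exact_mod_cast hD2
  set τ : ℕ → Fin (D + 1) → ℝ := fun a b => a * (100 * (D : ℝ) ^ 2) + 5 * (b : ℕ)
  set P : Finset ℝ := ((Finset.range (2 * D + 3)) ×ˢ (Finset.univ : Finset (Fin (D + 1)))).image
    fun ab => Real.exp (τ ab.1 ab.2)
  have hP : ∀ x ∈ P, 1 ≤ x ∧ x ≤ M := by
    intro x hx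
    obtain ⟨⟨a, b⟩, hab, rfl⟩ := Finset.mem_image.1 hx
    have ha : a ≤ 2 * D + 2 := by
      have := Finset.mem_range.1 (Finset.mem_product.1 hab).1
      omega
    have ha' : (a : ℝ) ≤ 2 * D + 2 := by exact_mod_cast ha
    have hb : ((b : ℕ) : ℝ) ≤ D := by exact_mod_cast Nat.lt_succ_iff.1 b.2
    refine ⟨Real.one_le_exp (by positivity), ?_⟩
    rw [← Real.le_log_iff_exp_le hM0]
    refine le_trans ?_ hlog
    have h1 := mul_le_mul_of_nonneg_right ha' (by positivity : 0 ≤ 100 * (D : ℝ) ^ 2)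
    have h2 : 0 ≤ (D : ℝ) ^ 2 * (D - 2) := mul_nonneg (sq_nonneg _) (by linarith)
    have h3 : 0 ≤ (D : ℝ) * (D - 2) := mul_nonneg (by linarith) (by linarith)
    nlinarith
  have h1M : 1 / M ≤ 1 := by
    rw [div_le_one hM0]
    exact hM.le
  obtain ⟨g, hg, hgP⟩ := exists_system_with_near_optimal_solutions S.residual
    S.totalDegree_residual_le S.eval_residual_nonneg (.inl ()) P
    -- Accuracy costs 1 and near-optimality another 1, whence the tolerance 2 around the logarithm.
    (fun x => Real.log x - 1) (fun x => Real.log x + 1)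
    (fun x hx => by
      have hx' := hP x hx
      have hmem : ![x, 1, Real.log x - 1] ∈ S.proj := by
        refine hS.1 ⟨⟨h1M.trans hx'.1, hx'.2⟩, ⟨h1M, hM.le⟩, ?_⟩
        simp only [hypLog, Set.mem_ofPred_eq]
        simp
        linarith
      obtain ⟨z, hz, hzt⟩ := S.exists_eval_residual_eq_zero hmem
      exact ⟨z, hz, hzt.ge⟩)
    (fun x _ z hz => by
      have hmem := hS.2 (S.mem_proj_of_eval_residual_eq_zero _ hz)
      have h2 := hmem.2.2.2
      simp at h2
      linarith)
  -- Since `5 ^ n = D / 2`, the left side is `D ^ 2 + D / 2`.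
  have hcard : (2 * D + 1) * 5 ^ Fintype.card (Unit ⊕ Fin p ⊕ Fin m ⊕ Fin m) < (D + 1) ^ 2 := by
    have h1 : Fintype.card (Unit ⊕ Fin p ⊕ Fin m ⊕ Fin m) = 1 + p + 2 * m := by
      simp
      ring
    rw [h1]
    nlinarith
  obtain ⟨c, ⟨i, j, hc⟩, hrel⟩ := exists_bivariate_relation
    {v | ∀ j, v (some j) ^ 5 = eval v (g j)} g hg (fun v hv => hv) (.inl ()) D hcard
  -- Scales beyond `2 * D + 2` get the dummy value 0, so that `choose` yields a total function.
  have hsol : ∀ a (b : Fin (D + 1)), ∃ y : ℝ, a ≤ 2 * D + 2 → |y - τ a b| ≤ 2 ∧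
      ∑ i, ∑ j, c i j * (Real.exp (τ a b) ^ (i : ℕ) * y ^ (j : ℕ)) = 0 := by
    intro a b
    by_cases ha : a ≤ 2 * D + 2
    · obtain ⟨v, hv0, hv, hv1, hv2⟩ := hgP (Real.exp (τ a b)) (Finset.mem_image.2
        ⟨(a, b), Finset.mem_product.2 ⟨Finset.mem_range.2 (by omega), Finset.mem_univ _⟩, rfl⟩)
      rw [Real.log_exp] at hv1 hv2
      refine ⟨v (some (.inl ())), fun _ => ⟨abs_le.2 ⟨by linarith, by linarith⟩, ?_⟩⟩
      rw [← hv0]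
      exact hrel v hv
    · exact ⟨0, fun h => absurd h ha⟩
  choose y hy using hsol
  exact hc (coeff_eq_zero_of_vanish_near_log hD2 c y (fun a ha b => (hy a b ha).1)
    (fun a ha b => (hy a b ha).2) i j)

theorem Kexp_mono {M α β : ℝ} (h : α ≤ β) : Kexp M α ⊆ Kexp M β := by
  rintro x ⟨h0, h1, h2, h3⟩
  exact ⟨h0, h1, h2, by linarith⟩

theorem IsSOCApprox.mono {M ε ε' : ℝ} {p m : ℕ} {S : SOCSystem (3 + p) m}
    (h : IsSOCApprox M ε S) (hε : ε ≤ ε') : IsSOCApprox M ε' S :=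
  ⟨(Kexp_mono (neg_le_neg hε)).trans h.1, h.2.trans (Kexp_mono hε)⟩

/-- Without constraints the projection contains the origin, which violates `x₁ ≥ 1 / M`. -/
theorem IsSOCApprox.one_le_size {M ε : ℝ} (hM : 1 < M) {p m : ℕ} {S : SOCSystem (3 + p) m}
    (h : IsSOCApprox M ε S) : 1 ≤ p + m := by
  by_contra! hlt
  obtain rfl : m = 0 := by omega
  have hM0 : 0 < 1 / M := by positivity
  have h0 : (0 : Fin 3 → ℝ) ∈ S.proj := ⟨0, fun i => i.elim0⟩
  have := (h.2 h0).1.1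
  simp only [Pi.zero_apply] at this
  linarith

/-- The size of an SOC approximation of accuracy at most one is bounded below by a multiple of
`log log M`. -/
theorem IsSOCApprox.log_log_le {M ε : ℝ} (hM : 1 < M) (hε : ε ≤ 1) {p m : ℕ}
    {S : SOCSystem (3 + p) m} (h : IsSOCApprox M ε S) :
    Real.log (Real.log M) ≤ 40 * ((p + m : ℕ) : ℝ) := by
  have h1 := log_lt_of_isSOCApprox_one hM S (h.mono hε) rfl
  have hlogM : 0 < Real.log M := Real.log_pos hM
  have hq : (1 : ℝ) ≤ ((p + m : ℕ) : ℝ) := by exact_mod_cast h.one_le_size hM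
  have h2 : (2 : ℝ) ≤ Real.exp 1 := by
    have := Real.exp_one_gt_d9
    linarith
  have h5 : (5 : ℝ) ≤ Real.exp 2 := by
    have h := Real.exp_one_gt_d9
    have h3 : Real.exp 2 = Real.exp 1 ^ 2 := by rw [← Real.exp_nat_mul]; norm_num
    rw [h3]
    nlinarith
  have h400 : (400 : ℝ) ≤ Real.exp 8 := by
    have h3 : Real.exp 8 = Real.exp 2 ^ 4 := by rw [← Real.exp_nat_mul]; norm_num
    rw [h3]
    refine le_trans ?_ (pow_le_pow_left₀ (by norm_num) h5 4)
    norm_num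
  have h3 : Real.log M ≤ Real.exp (8 + 3 * (1 + 2 * (1 + p + 2 * m))) := by
    refine h1.le.trans ?_
    have h4 : ((2 * 5 ^ (1 + p + 2 * m) : ℕ) : ℝ) ≤ Real.exp (1 + 2 * (1 + p + 2 * m)) := by
      push_cast
      calc (2 : ℝ) * 5 ^ (1 + p + 2 * m) ≤ Real.exp 1 * Real.exp 2 ^ (1 + p + 2 * m) := by gcongr
        _ = _ := by
          rw [← Real.exp_nat_mul, ← Real.exp_add]
          congr 1
          push_cast
          ring
    calc _ ≤ Real.exp 8 * Real.exp (1 + 2 * (1 + p + 2 * m)) ^ 3 := by gcongr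
      _ = _ := by
          rw [← Real.exp_nat_mul, ← Real.exp_add]
          congr 1
  -- The exponent is `17 + 6p + 12m`, and `p + m ≥ 1` absorbs the 17.
  have h6 := (Real.log_le_iff_le_exp hlogM).2 h3
  push_cast at hq ⊢
  have : (0 : ℝ) ≤ p := Nat.cast_nonneg p
  have : (0 : ℝ) ≤ m := Nat.cast_nonneg m
  linarith

/-- Dividing the double logarithm by a quantity that is bounded below keeps the bound. -/
theorem one_add_div_mul_le {l q r s : ℝ} (hl : l ≤ 40 * q) (hq : 1 ≤ q) (hr : 0 < r)
    (hrs : r ≤ s) : 1 / (1 + 40 / r) * (1 + l / s) ≤ q := by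
  -- As `l` may be negative, it is replaced by `40 * q` before `s` is replaced by `r`.
  have h1 : l / s ≤ 40 / r * q := by
    calc l / s ≤ 40 * q / s := by
          have := hr.trans_le hrs
          gcongr
      _ ≤ 40 * q / r := by gcongr
      _ = 40 / r * q := by ring
  rw [one_div, inv_mul_le_iff₀ (by positivity)]
  linarith

end ExpCone

theorem mainTheorem10 :
    (∃ c : ℝ, 0 < c ∧ ∀ M : ℝ, 1 < M → ∀ ε : ℝ, 0 < ε → ε ≤ 1 →
      ∀ (p m : ℕ) (C : ExpCone.SOCSystem (3 + p) m), ExpCone.IsSOCApprox M ε C →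
        c * (1 + Real.log (Real.log M) / (1 + Real.log (1 / ε))) ≤ ((p + m : ℕ) : ℝ)) ∧
    (∀ ε₀ : ℝ, 0 < ε₀ → ε₀ < 1 →
      ∃ c : ℝ, 0 < c ∧ ∀ M : ℝ, 1 < M → ∀ ε : ℝ, 0 < ε → ε ≤ ε₀ →
        ∀ (p m : ℕ) (C : ExpCone.SOCSystem (3 + p) m), ExpCone.IsSOCApprox M ε C →
          c * (1 + Real.log (Real.log M) / Real.log (1 / ε)) ≤ ((p + m : ℕ) : ℝ)) := by
  refine ⟨⟨1 / (1 + 40 / 1), by norm_num, fun M hM ε hε0 hε p m C hC => ?_⟩,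
    fun ε₀ hε₀ hε₁ => ?_⟩
  · have hlog : 0 ≤ Real.log (1 / ε) := Real.log_nonneg ((one_le_div hε0).2 hε)
    exact ExpCone.one_add_div_mul_le (hC.log_log_le hM hε)
      (by exact_mod_cast hC.one_le_size hM) one_pos (by linarith)
  · have hr : 0 < Real.log (1 / ε₀) := Real.log_pos ((one_lt_div hε₀).2 hε₁)
    refine ⟨1 / (1 + 40 / Real.log (1 / ε₀)), by positivity, fun M hM ε hε0 hε p m C hC => ?_⟩
    exact ExpCone.one_add_div_mul_le (hC.log_log_le hM (hε.trans hε₁.le))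
      (by exact_mod_cast hC.one_le_size hM) hr
      (Real.log_le_log (by positivity) (one_div_le_one_div_of_le hε0 hε))
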